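/- All compact groups are Hausdorff. For a compact group $G$ with normalized Haar measure $\mu$ and a closed subgroup $H\le G$ with normalized Haar measure $\nu$, let $\Pr(H,G)=(\nu\times\mu)\bigl(\{(x,y)\in H\times G : xy=yx\}\bigr)$. For $g\in G$ let $\langle g\rangle$ be the closed subgroup topologically generated by $g$. A closed subgroup $K\le G$ is called $\varepsilon$-central in $G$ if $\Pr(\langle g\rangle,G)\ge\varepsilon$ for every $g\in K$. For a positive integer $e$ let $K^e$ be the closed subgroup topologically generated by all $e$-th powers of elements of $K$, and for subgroups $A,B\le G$ let $[A,B]$ be the closed subgroup topologically generated by all commutators $[a,b]$ with $a\in A$, $b\in B$. Theorem. For every real $\varepsilon>0$ there is a number $N$ depending only on $\varepsilon$ such that the following holds. Let $G$ be a compact group and let $K$ be a closed subgroup of $G$ (possibly $K=G$) that is $\varepsilon$-central in $G$. Then there are a positive integer $e\le N$ and a closed normal subgroup $T$ of $G$ such that the index $[G:T]$ and the order of $[K^e,T]$ are both finite and at most $N$. -/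

import Mathlib

open MeasureTheory

noncomputable section

/-- The normalized Haar measure of a compact group: the left-invariant regular Borel measure of
total mass `1`. -/
def normalizedHaar (G : Type*) [Group G] [TopologicalSpace G] [IsTopologicalGroup G]
    [CompactSpace G] [MeasurableSpace G] [BorelSpace G] : Measure G :=
  Measure.haarMeasure (⊤ : TopologicalSpace.PositiveCompacts G)

/-- The set of pairs `(x, y)` in `K × G` such that `x` and `y` commute. -/
def commutingPairs {G : Type*} [Group G] (K : Subgroup G) : Set (K × G) :=
  {p | (p.1 : G) * p.2 = p.2 * (p.1 : G)}

/-- `Pr(K, G) = (ν × μ) {(x, y) ∈ K × G | x y = y x}`, with `ν` and `μ` the normalized Haar measures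
of the compact groups `K` and `G`. The set of commuting pairs is compact. When `G` is not second
countable that set need not lie in the product σ-algebra; the value below is then its outer measure,
which for a compact set is the infimum of the measures of the finite unions of open rectangles
containing it, and so is its measure for the Radon product of `ν` and `μ`. -/
def commutingProb {G : Type*} [Group G] [TopologicalSpace G] [IsTopologicalGroup G]
    [CompactSpace G] [MeasurableSpace G] [BorelSpace G] (K : Subgroup G) [CompactSpace K] : ℝ :=
  ((normalizedHaar K).prod (normalizedHaar G)).real (commutingPairs K)

/-- The monothetic subgroup (topologically) generated by `g`. -/
def monothetic {G : Type*} [Group G] [TopologicalSpace G] [IsTopologicalGroup G] (g : G) :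
    Subgroup G :=
  (Subgroup.zpowers g).topologicalClosure

instance monothetic.compactSpace {G : Type*} [Group G] [TopologicalSpace G] [IsTopologicalGroup G]
    [CompactSpace G] (g : G) : CompactSpace (monothetic g) :=
  isCompact_iff_compactSpace.mp (Subgroup.zpowers g).isClosed_topologicalClosure.isCompact

/-- `K` is `ε`-central in `G`: `Pr(⟨g⟩, G) ≥ ε` for every `g ∈ K`. -/
def IsEpsCentral {G : Type*} [Group G] [TopologicalSpace G] [IsTopologicalGroup G]
    [CompactSpace G] [MeasurableSpace G] [BorelSpace G] (ε : ℝ) (K : Subgroup G) : Prop :=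
  ∀ g ∈ K, ε ≤ commutingProb (monothetic g)

/-- `K ^ e`: the closed subgroup (topologically) generated by the `e`-th powers of elements
of `K`. -/
def powerSubgroup {G : Type*} [Group G] [TopologicalSpace G] [IsTopologicalGroup G]
    (K : Subgroup G) (e : ℕ) : Subgroup G :=
  (Subgroup.closure {x : G | ∃ k ∈ K, k ^ e = x}).topologicalClosure

/-- `[A, B]`: the closed subgroup (topologically) generated by the commutators of elements of `A`
with elements of `B`. -/
def closedCommutator {G : Type*} [Group G] [TopologicalSpace G] [IsTopologicalGroup G]
    (A B : Subgroup G) : Subgroup G :=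
  (⁅A, B⁆ : Subgroup G).topologicalClosure

end

/-! Write `m = ⌊2/ε⌋` and `n = m²`. If `Pr(⟨g⟩, G) ≥ ε`, the elements of `⟨g⟩` whose centralizer has
measure at least `ε/2` fill a set of measure at least `ε/2`. Two of its translates by `1, g, ...,
g^m` meet, so some `g^k` with `1 ≤ k ≤ m` is a quotient of two such elements and its centralizer has
index at most `n` (`exists_index_centralizer_pow_le`). Hence every `m!`-th power of an element of
`K` has a centralizer of index at most `n`.

The rest is abstract group theory. An `n!`-th power commutes with any element whose centralizer has
index at most `n`, so with `d = m! * n!` the conjugates of `d`-th powers from `K` commute and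
generate an abelian normal subgroup `A`. Every element of the subgroup `P` generated by the `d²`-th
powers is itself a `d`-th power from `K ∩ A`, so all its centralizers have index at most `n`
(`Subgroup.exists_card_commutator_pow_le`). A covering argument reverses the roles: a subgroup `T`
of index at most `n` consists of elements whose centralizers in `P` have bounded index
(`Subgroup.exists_relIndex_centralizer_le`). The maps `x ↦ ⁅t, x⁆` are then homomorphisms `P → A`
with few values for fixed `t` and for fixed `x`, hence few values overall
(`Set.encard_range_hom_family_le`), and these values generate a group of bounded order. Finally `T`
is replaced by its normal core and closures are taken. -/

open scoped commutatorElement Pointwise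

/-! ### Counting values of homomorphisms into abelian groups -/

/-- A family of homomorphisms to a commutative group such that each homomorphism takes at most `M`
values and each point has at most `n` images takes boundedly many values altogether. -/
theorem Set.encard_range_hom_family_le {T K A : Type*} [Group K] [CommGroup A] (φ : T → K →* A)
    {n M : ℕ} (hM : 0 < M) (hn : ∀ x, (Set.range fun t => φ t x).encard ≤ n)
    (hφ : ∀ t, (Set.range (φ t)).encard ≤ M) :
    (Set.range fun p : T × K => φ p.1 p.2).encard ≤ (M ^ n * (n * n * n) : ℕ) := by
  classical
  rcases isEmpty_or_nonempty T with hT | hT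
  · rw [Set.range_eq_empty, Set.encard_empty]
    exact bot_le
  have fin1 : ∀ x, (Set.range fun t => φ t x).Finite := fun x => Set.finite_of_encard_le_coe (hn x)
  have fin2 : ∀ t, (Set.range (φ t)).Finite := fun t => Set.finite_of_encard_le_coe (hφ t)
  let R : K → Finset A := fun x => (fin1 x).toFinset
  have hR : ∀ x, (R x).card ≤ n := fun x => by
    have := hn x
    rw [(fin1 x).encard_eq_coe_toFinset_card] at this
    exact_mod_cast this
  have memR : ∀ t x, φ t x ∈ R x := fun t x => by simp [R]
  -- Choose `a` with the most images; the at most `n` indices in `F` will already realize all of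
  -- them.
  obtain ⟨a, ha⟩ : ∃ a, ∀ x, (R x).card ≤ (R a).card := by
    obtain ⟨_, ⟨⟨a, rfl⟩, ha⟩⟩ := (BddAbove.finite (s := Set.range fun x => (R x).card)
      ⟨n, by rintro _ ⟨x, rfl⟩; exact hR x⟩).exists_maximal ⟨_, 1, rfl⟩
    refine ⟨a, fun x => ?_⟩
    rcases le_total (R x).card (R a).card with h | h
    · exact h
    · exact ha ⟨x, rfl⟩ h
  have hpre : ∀ c ∈ R a, ∃ t, φ t a = c := fun c hc => by simpa [R] using hc
  choose! b hb using hpre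
  let F : Finset T := (R a).image b
  let V : T → Finset A := fun t => (fin2 t).toFinset
  have hV : ∀ t, (V t).card ≤ M := fun t => by
    have := hφ t
    rw [(fin2 t).encard_eq_coe_toFinset_card] at this
    exact_mod_cast this
  let P : Finset (F → A) := Fintype.piFinset fun t => V t
  have hP : P.card ≤ M ^ n := by
    rw [Fintype.card_piFinset]
    calc ∏ t : F, (V t).card ≤ ∏ _t : F, M := Finset.prod_le_prod' fun t _ => hV t
      _ = M ^ F.card := by simp
      _ ≤ M ^ n := Nat.pow_le_pow_right hM (Finset.card_image_le.trans (hR a))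
  -- Multiplying `a` by an element `u` of the common kernel of `F` keeps all images of `a`, and by
  -- maximality adds none, so `φ t u = φ t (u * a) / φ t a` lies in `R a / R a` for every `t`.
  have key : ∀ u : K, (∀ t ∈ F, φ t u = 1) → ∀ t, φ t u ∈ R a / R a := by
    intro u hu t
    have hsub : R a ⊆ R (u * a) := by
      intro c hc
      have h1 : φ (b c) (u * a) = c := by
        rw [map_mul, hu _ (Finset.mem_image_of_mem b hc), one_mul, hb c hc]
      exact h1 ▸ memR (b c) (u * a)
    have heq : R a = R (u * a) := Finset.eq_of_subset_of_card_le hsub (ha _)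
    have : φ t u = φ t (u * a) / φ t a := by rw [map_mul, mul_div_cancel_right]
    rw [this]
    exact Finset.div_mem_div (heq ▸ memR t (u * a)) (memR t a)
  have hrep : ∀ v : F → A, ∃ y : K, (∃ x : K, ∀ t : F, φ t x = v t) → ∀ t : F, φ t y = v t := by
    intro v
    by_cases h : ∃ x : K, ∀ t : F, φ t x = v t
    · exact ⟨h.choose, fun _ => h.choose_spec⟩
    · exact ⟨1, fun h' => absurd h' h⟩
  choose y hy using hrep
  -- The common kernel of `F` has at most `M ^ n` cosets, labelled by the value vectors `v`; each
  -- contributes at most `n² * n` values.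
  let S : Finset A := P.biUnion fun v => R a / R a * R (y v)
  have hS : (Set.range fun p : T × K => φ p.1 p.2) ⊆ S := by
    rintro _ ⟨⟨t, x⟩, rfl⟩
    let v : F → A := fun s => φ s x
    have hv : v ∈ P := Fintype.mem_piFinset.2 fun s => by simp [V, v]
    have hyv := hy v ⟨x, fun _ => rfl⟩
    refine Finset.mem_coe.2 (Finset.mem_biUnion.2 ⟨v, hv, ?_⟩)
    have h1 : φ t x = φ t (x * (y v)⁻¹) * φ t (y v) := by rw [← map_mul, inv_mul_cancel_right]
    change φ t x ∈ _
    rw [h1]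
    refine Finset.mul_mem_mul (key _ (fun s hs => ?_) t) (memR t _)
    rw [map_mul, map_inv, hyv ⟨s, hs⟩]
    exact mul_inv_cancel _
  calc _ ≤ (S : Set A).encard := Set.encard_le_encard hS
    _ = (S.card : ℕ∞) := Set.encard_coe_eq_coe_finsetCard S
    _ ≤ _ := by
      refine Nat.cast_le.2 ((Finset.card_biUnion_le_card_mul _ _ _ fun v _ => ?_).trans
        (Nat.mul_le_mul_right _ hP))
      exact Finset.card_mul_le.trans (Nat.mul_le_mul (Finset.card_div_le.trans
        (Nat.mul_le_mul (hR a) (hR a))) (hR _))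

/-- A finite set of elements of a commutative group that contains all powers of its elements
generates a finite subgroup of bounded order. -/
theorem Subgroup.card_closure_le_of_zpowers_subset {A : Type*} [CommGroup A] {S : Set A} {s : ℕ}
    (hS : S.encard ≤ s) (hpow : ∀ c ∈ S, (zpowers c : Set A) ⊆ S) :
    Finite (closure S) ∧ Nat.card (closure S) ≤ s ^ s := by
  classical
  have hfin := Set.finite_of_encard_le_coe hS
  have hcard : hfin.toFinset.card ≤ s := by
    rw [hfin.encard_eq_coe_toFinset_card] at hS
    exact_mod_cast hS
  have hz : ∀ c ∈ S, Finite (zpowers c) ∧ Nat.card (zpowers c) ≤ s := by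
    intro c hc
    have h1 := hfin.subset (hpow c hc)
    refine ⟨h1, ?_⟩
    have h2 := (Set.encard_le_encard (hpow c hc)).trans hS
    rw [← h1.cast_ncard_eq] at h2
    exact_mod_cast h2
  have main : ∀ F : Finset A, (F : Set A) ⊆ S →
      Finite (closure (F : Set A)) ∧ Nat.card (closure (F : Set A)) ≤ s ^ F.card := by
    intro F
    induction F using Finset.induction_on with
    | empty => intro _; rw [Finset.coe_empty, closure_empty]; exact ⟨inferInstance, by simp⟩
    | insert c F hc ih =>
      intro hF
      rw [Finset.coe_insert, Set.insert_subset_iff] at hF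
      obtain ⟨f1, c1⟩ := ih hF.2
      obtain ⟨f2, c2⟩ := hz c hF.1
      have e : ((closure (insert c F : Finset A) : Subgroup A) : Set A)
          = (zpowers c : Set A) * (closure (F : Set A) : Set A) := by
        rw [Finset.coe_insert, Set.insert_eq, closure_union, ← zpowers_eq_closure, mul_normal]
      refine ⟨?_, ?_⟩
      · have : ((closure (insert c F : Finset A) : Subgroup A) : Set A).Finite := by
          rw [e]; exact Set.Finite.mul f2 f1
        exact this
      · calc Nat.card ((closure (insert c F : Finset A) : Subgroup A) : Set A)
            ≤ Nat.card (zpowers c : Set A) * Nat.card (closure (F : Set A) : Set A) := by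
              rw [e]; exact Set.natCard_mul_le
          _ ≤ s * s ^ F.card := Nat.mul_le_mul c2 c1
          _ = s ^ (insert c F).card := by rw [Finset.card_insert_of_notMem hc, pow_succ']
  obtain ⟨f, c⟩ := main hfin.toFinset (by simp)
  rw [hfin.coe_toFinset] at f c
  refine ⟨f, c.trans ?_⟩
  rcases s.eq_zero_or_pos with rfl | h
  · rw [Nat.le_zero.1 hcard]
  · exact Nat.pow_le_pow_right h hcard

/-! ### Centralizers of bounded index and a covering argument -/

/-- Let `Y 1 ⊆ Y 2 ⊆ ⋯` be symmetric sets with `Y a * Y b ⊆ Y (a * b)`. If among any `r + 1` elements of the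
group two are congruent modulo `Y M`, then some `Y M'` contains a subgroup of index at most `r`. -/
theorem Subgroup.exists_index_le_of_filtration {G : Type*} [Group G] (Y : ℕ → Set G)
    (hmono : Monotone Y) (hone : 1 ∈ Y 1) (hinv : ∀ a, ∀ x ∈ Y a, x⁻¹ ∈ Y a)
    (hmul : ∀ a b, ∀ x ∈ Y a, ∀ y ∈ Y b, x * y ∈ Y (a * b)) (r : ℕ) {M : ℕ} (hM : 0 < M)
    (h : ∀ y : Fin (r + 1) → G, ∃ i j, i ≠ j ∧ (y i)⁻¹ * y j ∈ Y M) :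
    ∃ T : Subgroup G, T.index ≠ 0 ∧ T.index ≤ r ∧ (T : Set G) ⊆ Y (M ^ 3 ^ r) := by
  induction r generalizing M with
  | zero =>
    obtain ⟨i, j, hij, -⟩ := h fun _ => 1
    exact absurd (Fin.ext (by omega)) hij
  | succ r ih =>
    by_cases h' : ∀ y : Fin (r + 1) → G, ∃ i j, i ≠ j ∧ (y i)⁻¹ * y j ∈ Y (M ^ 3)
    · obtain ⟨T, h1, h2, h3⟩ := ih (pow_pos hM 3) h'
      refine ⟨T, h1, h2.trans r.le_succ, ?_⟩
      rwa [← pow_mul, ← pow_succ'] at h3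
    -- Now `y` consists of `r + 1` elements pairwise incongruent modulo `Y (M ^ 3)`. Adjoining any
    -- `z` forces a congruence modulo `Y M`, which must involve `z`.
    push Not at h'
    obtain ⟨y, hy⟩ := h'
    have hM3 : M ≤ M ^ 3 := Nat.le_self_pow (by norm_num) M
    have hM2 : M * M ≤ M ^ 3 := by
      rw [← pow_two]; exact Nat.pow_le_pow_right hM (by norm_num)
    have cover : ∀ z : G, ∃ i, (y i)⁻¹ * z ∈ Y M := by
      intro z
      obtain ⟨i, j, hij, hm⟩ := h (Fin.cons z y)
      induction i using Fin.cases with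
      | zero =>
        induction j using Fin.cases with
        | zero => exact absurd rfl hij
        | succ j =>
          refine ⟨j, ?_⟩
          have := hinv _ _ hm
          simpa using this
      | succ i =>
        induction j using Fin.cases with
        | zero => exact ⟨i, by simpa using hm⟩
        | succ j =>
          refine absurd (hmono hM3 hm) ?_
          simpa using hy i j (fun e => hij (by rw [e]))
    -- If `y 0 * z` were close to `y i` with `i ≠ 0`, then `y 0` and `y i` would be congruent modulo
    -- `Y (M * M * M)`. So `i = 0`, and `Y M` is closed under products.
    have close : ∀ z ∈ Y (M * M), z ∈ Y M := by
      intro z hz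
      obtain ⟨i, hi⟩ := cover (y 0 * z)
      by_cases h0 : 0 = i
      · subst h0; simpa using hi
      · refine absurd ?_ (hy 0 i h0)
        have := hmul _ _ _ hz _ (hinv _ _ hi)
        rw [show M ^ 3 = M * M * M by ring]
        convert this using 1
        group
    let T : Subgroup G :=
      { carrier := Y M
        one_mem' := hmono hM hone
        inv_mem' := fun hx => hinv _ _ hx
        mul_mem' := fun hx hy => close _ (hmul _ _ _ hx _ hy) }
    have hsurj : Function.Surjective fun i => (y i : G ⧸ T) := by
      intro q
      induction q using QuotientGroup.induction_on with
      | H z =>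
        obtain ⟨i, hi⟩ := cover z
        exact ⟨i, QuotientGroup.eq.2 hi⟩
    have : Finite (G ⧸ T) := Finite.of_surjective _ hsurj
    refine ⟨T, Subgroup.index_ne_zero_of_finite, ?_, ?_⟩
    · simpa [Subgroup.index] using Nat.card_le_card_of_surjective _ hsurj
    · exact hmono (Nat.le_self_pow (by positivity) M)

/-- If all centralizers of elements of `K` have index at most `n`, then some subgroup `T` of index at
most `n` consists of elements whose centralizers in `K` have bounded index. -/
theorem Subgroup.exists_relIndex_centralizer_le {G : Type*} [Group G] (K : Subgroup G) {n : ℕ}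
    (hK : ∀ x ∈ K, (centralizer {x}).index ≠ 0 ∧ (centralizer {x}).index ≤ n) :
    ∃ T : Subgroup G, T.index ≠ 0 ∧ T.index ≤ n ∧ ∀ t ∈ T,
      (centralizer {t}).relIndex K ≠ 0 ∧
        (centralizer {t}).relIndex K ≤ ((n + 1) * (n + 1)) ^ 3 ^ n := by
  refine exists_index_le_of_filtration
    (fun M => {t | (centralizer {t}).relIndex K ≠ 0 ∧ (centralizer {t}).relIndex K ≤ M})
    (fun a b hab t ht => ⟨ht.1, ht.2.trans hab⟩) ?_ ?_ ?_ n (by positivity) ?_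
  · have : centralizer {(1 : G)} = ⊤ := by
      ext; simp [mem_centralizer_singleton_iff]
    simp [this]
  · intro a t ht
    have : centralizer {t⁻¹} = centralizer {t} := by
      ext z
      simp only [mem_centralizer_singleton_iff]
      exact (Commute.inv_right_iff (a := z) (b := t))
    simpa [this] using ht
  · intro a b t ht s hs
    have hle : centralizer {t} ⊓ centralizer {s} ≤ centralizer {t * s} := by
      intro z hz
      simp only [mem_inf, mem_centralizer_singleton_iff] at hz ⊢
      exact Commute.mul_right (a := z) hz.1 hz.2
    have hne : (centralizer {t} ⊓ centralizer {s}).relIndex K ≠ 0 := relIndex_inf_ne_zero ht.1 hs.1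
    refine ⟨fun h0 => hne (relIndex_eq_zero_of_le_left hle h0), ?_⟩
    exact (relIndex_le_of_le_left hle hne).trans (relIndex_inf_le.trans (Nat.mul_le_mul ht.2 hs.2))
  · intro y
    let s : Finset (Fin (n + 1) × Fin (n + 1)) := Finset.univ.filter fun p => p.1 ≠ p.2
    -- By pigeonhole each `x ∈ K` centralizes some `(y i)⁻¹ * y j`, so B. H. Neumann's covering
    -- lemma applies to these centralizers in `K`. The diagonal is left out because there the
    -- centralizer is everything.
    have hcov : ⋃ p ∈ s, (1 : K) •
        (((centralizer {(y p.1)⁻¹ * y p.2}).subgroupOf K : Subgroup K) : Set K) = Set.univ := by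
      refine Set.eq_univ_of_forall fun x => ?_
      have hx := hK x x.2
      have : Finite (G ⧸ centralizer {(x : G)}) := finiteIndex_iff_finite_quotient.1 ⟨hx.1⟩
      have hnotinj : ¬ Function.Injective fun i => (y i : G ⧸ centralizer {(x : G)}) := by
        intro hi
        have := Nat.card_le_card_of_injective _ hi
        rw [Nat.card_fin] at this
        exact absurd (this.trans hx.2) (by omega)
      rw [Function.not_injective_iff] at hnotinj
      obtain ⟨i, j, hq, hij⟩ := hnotinj
      rw [QuotientGroup.eq, mem_centralizer_singleton_iff] at hq
      refine Set.mem_iUnion₂.2 ⟨(i, j), by simp [s, hij], ?_⟩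
      rw [one_smul, SetLike.mem_coe, mem_subgroupOf, mem_centralizer_singleton_iff]
      exact hq.symm
    obtain ⟨p, hp, hfi, hle⟩ := exists_index_le_card_of_leftCoset_cover hcov
    refine ⟨p.1, p.2, by simpa [s] using hp, hfi.index_ne_zero, hle.trans ?_⟩
    simpa using Finset.card_le_univ s

/-! ### Bounding the commutator subgroup inside an abelian normal subgroup -/

theorem Subgroup.encard_range_commutatorElement_le {G : Type*} [Group G] (x : G) {n : ℕ}
    (h0 : (centralizer {x}).index ≠ 0) (hn : (centralizer {x}).index ≤ n) :
    (Set.range fun g : G => ⁅g, x⁆).encard ≤ n := by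
  have : Finite (G ⧸ centralizer {x}) := finiteIndex_iff_finite_quotient.1 ⟨h0⟩
  have hsub : (Set.range fun g : G => ⁅g, x⁆) ⊆
      Set.range fun q : G ⧸ centralizer {x} => ⁅q.out, x⁆ := by
    rintro _ ⟨g, rfl⟩
    refine ⟨g, ?_⟩
    have h := QuotientGroup.eq.1 (QuotientGroup.out_eq' (g : G ⧸ centralizer {x}))
    rw [mem_centralizer_singleton_iff] at h
    have h2 : g * x * g⁻¹ = (g : G ⧸ centralizer {x}).out * x * (g : G ⧸ centralizer {x}).out⁻¹ := by
      generalize (g : G ⧸ centralizer {x}).out = o at h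
      calc g * x * g⁻¹ = o * (o⁻¹ * g * x) * g⁻¹ := by group
        _ = o * (x * (o⁻¹ * g)) * g⁻¹ := by rw [h]
        _ = _ := by group
    simp only [commutatorElement_def, h2]
  refine (Set.encard_le_encard hsub).trans ?_
  rw [← Set.image_univ]
  refine (Set.encard_image_le _ _).trans ?_
  rw [Set.encard_univ, ENat.card_eq_coe_natCard]
  exact_mod_cast hn

/-- The bound on the number of commutators in `Subgroup.exists_card_commutator_le`. -/
def commutatorBound (n : ℕ) : ℕ :=
  (((n + 1) * (n + 1)) ^ 3 ^ n) ^ n * (n * n * n)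

/-- If `K` lies in an abelian normal subgroup of `G` and all centralizers of elements of `K` have index
at most `n`, then `⁅T, K⁆` has bounded order for some subgroup `T` of index at most `n`. -/
theorem Subgroup.exists_card_commutator_le {G : Type*} [Group G] (K A : Subgroup G) [A.Normal]
    (comm : ∀ x ∈ A, ∀ y ∈ A, x * y = y * x) (hKA : K ≤ A) {n : ℕ}
    (hK : ∀ x ∈ K, (centralizer {x}).index ≠ 0 ∧ (centralizer {x}).index ≤ n) :
    ∃ T : Subgroup G, T.index ≠ 0 ∧ T.index ≤ n ∧ Finite (⁅T, K⁆ : Subgroup G) ∧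
      Nat.card (⁅T, K⁆ : Subgroup G) ≤ commutatorBound n ^ commutatorBound n := by
  obtain ⟨T, hT0, hTn, hT⟩ := K.exists_relIndex_centralizer_le hK
  refine ⟨T, hT0, hTn, ?_⟩
  have memA : ∀ t : G, ∀ x ∈ A, ⁅t, x⁆ ∈ A := fun t x hx =>
    A.mul_mem (Normal.conj_mem inferInstance x hx t) (A.inv_mem hx)
  let _ : CommGroup A := { mul_comm := fun x y => Subtype.ext (comm x x.2 y y.2) }
  -- `⁅t, x * y⁆ = ⁅t, x⁆ * (x * ⁅t, y⁆ * x⁻¹)`, and `x` commutes with `⁅t, y⁆` since both lie in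
  -- `A`.
  let φ : T → K →* A := fun t => MonoidHom.mk' (fun x => ⟨⁅(t : G), (x : G)⁆, memA t x (hKA x.2)⟩) <| by
    intro x y
    apply Subtype.ext
    change ⁅(t : G), (x : G) * y⁆ = ⁅(t : G), (x : G)⁆ * ⁅(t : G), (y : G)⁆
    have h1 := comm _ (hKA x.2) _ (memA t y (hKA y.2))
    calc ⁅(t : G), (x : G) * y⁆ = ⁅(t : G), (x : G)⁆ * (x * ⁅(t : G), (y : G)⁆) * (x : G)⁻¹ := by
          simp only [commutatorElement_def]; group
      _ = _ := by rw [h1]; group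
  have hφ : ∀ t x, ((φ t x : A) : G) = ⁅(t : G), (x : G)⁆ := fun _ _ => rfl
  have hx : ∀ x, (Set.range fun t => φ t x).encard ≤ n := by
    intro x
    refine le_trans ?_ (encard_range_commutatorElement_le (x : G) (hK x x.2).1 (hK x x.2).2)
    rw [← Subtype.val_injective.encard_image]
    refine Set.encard_le_encard ?_
    rintro _ ⟨_, ⟨t, rfl⟩, rfl⟩
    exact ⟨t, rfl⟩
  have ht : ∀ t, (Set.range (φ t)).encard ≤ (((n + 1) * (n + 1)) ^ 3 ^ n : ℕ) := by
    intro t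
    have hker : (φ t).ker = (centralizer {(t : G)}).subgroupOf K := by
      ext x
      rw [MonoidHom.mem_ker, mem_subgroupOf, mem_centralizer_singleton_iff, ← Subtype.val_inj, hφ]
      rw [eq_comm (a := (x : G) * t)]
      exact commutatorElement_eq_one_iff_mul_comm
    have hcard := index_ker (φ t)
    rw [hker] at hcard
    have h := hT t t.2
    rw [relIndex, hcard] at h
    have : Finite (φ t).range := Nat.finite_of_card_ne_zero h.1
    have hfin : (Set.range (φ t)).Finite := this
    rw [← hfin.cast_ncard_eq]
    exact_mod_cast h.2
  have hS := Set.encard_range_hom_family_le φ (by positivity) hx ht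
  obtain ⟨f, c⟩ := card_closure_le_of_zpowers_subset hS <| by
    rintro _ ⟨⟨t, x⟩, rfl⟩ _ ⟨k, rfl⟩
    exact ⟨(t, x ^ k), map_zpow (φ t) x k⟩
  have heq : (⁅T, K⁆ : Subgroup G) = (closure (Set.range fun p : T × K => φ p.1 p.2)).map A.subtype := by
    rw [MonoidHom.map_closure, commutator_def]
    congr 1
    ext z
    constructor
    · rintro ⟨t, ht, x, hx, rfl⟩
      exact ⟨_, ⟨(⟨t, ht⟩, ⟨x, hx⟩), rfl⟩, rfl⟩
    · rintro ⟨_, ⟨⟨t, x⟩, rfl⟩, rfl⟩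
      exact ⟨t, t.2, x, x.2, rfl⟩
  rw [heq]
  have e := (closure (Set.range fun p : T × K => φ p.1 p.2)).equivMapOfInjective A.subtype
    A.subtype_injective
  exact ⟨Finite.of_equiv _ e.toEquiv, (Nat.card_congr e.toEquiv).symm.trans_le c⟩

open scoped Nat

/-! ### Powers that generate an abelian normal subgroup -/

theorem Subgroup.commute_pow_factorial {G : Type*} [Group G] (g h : G) {n : ℕ}
    (h0 : (centralizer {h}).index ≠ 0) (hn : (centralizer {h}).index ≤ n) :
    Commute (g ^ n !) h := by
  obtain ⟨i, hi, hle, hmem⟩ := exists_pow_mem_of_index_ne_zero h0 g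
  obtain ⟨c, hc⟩ := Nat.dvd_factorial hi (hle.trans hn)
  rw [hc, pow_mul]
  exact (show Commute (g ^ i) h from mem_centralizer_singleton_iff.1 hmem).pow_left c

theorem Subgroup.index_normalCore_le {G : Type*} [Group G] (H : Subgroup G) (h : H.index ≠ 0) :
    H.normalCore.index ≠ 0 ∧ H.normalCore.index ≤ H.index ! := by
  have : H.FiniteIndex := ⟨h⟩
  refine ⟨FiniteIndex.index_ne_zero, ?_⟩
  rw [normalCore_eq_ker, index_ker, index, ← Nat.card_perm]
  exact Nat.card_le_card_of_injective _ Subtype.val_injective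

/-- If the `e`-th powers of elements of `K` have centralizers of index at most `n`, then for a multiple
`e'` of `e` the subgroup generated by the `e'`-th powers has a finite commutator with a normal subgroup
of bounded index. -/
theorem Subgroup.exists_card_commutator_pow_le {G : Type*} [Group G] (K : Subgroup G) {e n : ℕ}
    (hK : ∀ k ∈ K, (centralizer {k ^ e}).index ≠ 0 ∧ (centralizer {k ^ e}).index ≤ n) :
    ∃ T : Subgroup G, T.Normal ∧ T.index ≠ 0 ∧ T.index ≤ n ! ∧
      Finite (⁅closure {x : G | ∃ k ∈ K, k ^ ((e * n !) * (e * n !)) = x}, T⁆ : Subgroup G) ∧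
      Nat.card (⁅closure {x : G | ∃ k ∈ K, k ^ ((e * n !) * (e * n !)) = x}, T⁆ : Subgroup G) ≤
        commutatorBound n ^ commutatorBound n := by
  set d := e * n ! with hd
  set P := closure {x : G | ∃ k ∈ K, k ^ (d * d) = x}
  let S : Set G := {x : G | ∃ k ∈ K, k ^ d = x}
  let A := normalClosure S
  have conj : ∀ x ∈ Group.conjugatesOfSet S, ∀ y ∈ Group.conjugatesOfSet S, Commute x y := by
    intro x hx y hy
    obtain ⟨_, ⟨k, hk, rfl⟩, hx⟩ := Group.mem_conjugatesOfSet_iff.1 hx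
    obtain ⟨_, ⟨l, hl, rfl⟩, hy⟩ := Group.mem_conjugatesOfSet_iff.1 hy
    obtain ⟨a, rfl⟩ := isConj_iff.1 hx
    obtain ⟨b, rfl⟩ := isConj_iff.1 hy
    -- After conjugating by `b⁻¹` only one conjugate remains. The factor `n !` of `d` is spent on
    -- the left element, which need not lie in `K`, and the factor `e` on `l`.
    have h1 : Commute ((b⁻¹ * (a * k * a⁻¹) * b) ^ d) (l ^ d) := by
      rw [hd, pow_mul l, pow_mul' _ e]
      have := commute_pow_factorial (b⁻¹ * (a * k * a⁻¹) * b) (l ^ e) (hK l hl).1 (hK l hl).2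
      exact this.pow_pow e _
    have h2 := h1.conj b
    rw [← conj_pow, ← conj_pow] at h2
    rw [← conj_pow, ← conj_pow]
    convert h2 using 2
    group
  have comm : ∀ x ∈ A, ∀ y ∈ A, x * y = y * x := by
    have hle : A ≤ centralizer (A : Set G) := by
      change closure _ ≤ centralizer ((closure (Group.conjugatesOfSet S) : Subgroup G) : Set G)
      rw [centralizer_closure, closure_le]
      intro x hx
      exact fun y hy => (conj x hx y hy).symm
    exact fun x hx y hy => (mem_centralizer_iff.1 (hle hx) y hy).symm
  have pow_mem : ∀ k ∈ K, k ^ d ∈ A := fun k hk => subset_normalClosure ⟨k, hk, rfl⟩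
  -- This is why the exponent is `d * d`: one factor `d` moves into the abelian group `A`, where the
  -- `d`-th powers of elements of `K ⊓ A` already form a subgroup.
  have hP : ∀ x ∈ P, ∃ z ∈ K ⊓ A, z ^ d = x := by
    intro x hx
    induction hx using closure_induction with
    | mem x hx =>
      obtain ⟨k, hk, rfl⟩ := hx
      exact ⟨k ^ d, ⟨K.pow_mem hk d, pow_mem k hk⟩, (pow_mul k d d).symm⟩
    | one => exact ⟨1, one_mem _, one_pow d⟩
    | mul x y _ _ hx hy =>
      obtain ⟨z, hz, rfl⟩ := hx
      obtain ⟨w, hw, rfl⟩ := hy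
      exact ⟨z * w, mul_mem hz hw, Commute.mul_pow (comm z hz.2 w hw.2) d⟩
    | inv x _ hx =>
      obtain ⟨z, hz, rfl⟩ := hx
      exact ⟨z⁻¹, inv_mem hz, inv_pow z d⟩
  have hPA : P ≤ A := by
    intro x hx
    obtain ⟨z, hz, rfl⟩ := hP x hx
    exact A.pow_mem hz.2 d
  have hPn : ∀ x ∈ P, (centralizer {x}).index ≠ 0 ∧ (centralizer {x}).index ≤ n := by
    intro x hx
    obtain ⟨z, hz, rfl⟩ := hP x hx
    have hle : centralizer {z ^ e} ≤ centralizer {z ^ d} := by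
      intro g hg
      rw [mem_centralizer_singleton_iff] at hg ⊢
      rw [hd, pow_mul]
      exact Commute.pow_right (a := g) hg _
    have h := hK z hz.1
    have : (centralizer {z ^ e}).FiniteIndex := ⟨h.1⟩
    exact ⟨(finiteIndex_of_le hle).index_ne_zero, (index_antitone hle).trans h.2⟩
  obtain ⟨T, hT0, hTn, hf, hc⟩ := P.exists_card_commutator_le A comm hPA hPn
  have hle : ⁅P, T.normalCore⁆ ≤ (⁅T, P⁆ : Subgroup G) := by
    rw [commutator_comm T P]
    exact commutator_mono le_rfl T.normalCore_le
  obtain ⟨h0, hi⟩ := T.index_normalCore_le hT0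
  exact ⟨T.normalCore, inferInstance, h0, hi.trans (Nat.factorial_le hTn),
    Finite.of_injective _ (inclusion_injective hle),
    (Nat.card_le_card_of_injective _ (inclusion_injective hle)).trans hc⟩

/-! ### Passing to closures -/

section Topology

variable {G : Type*} [Group G] [TopologicalSpace G] [IsTopologicalGroup G]

theorem Subgroup.index_topologicalClosure_le (T : Subgroup G) (h : T.index ≠ 0) :
    T.topologicalClosure.index ≠ 0 ∧ T.topologicalClosure.index ≤ T.index := by
  have : T.FiniteIndex := ⟨h⟩
  exact ⟨(finiteIndex_of_le T.le_topologicalClosure).index_ne_zero,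
    index_antitone T.le_topologicalClosure⟩

/-- A finite subgroup of a Hausdorff group is closed, so by continuity of the commutator map it
still contains the commutators of limit points. -/
theorem closedCommutator_topologicalClosure_le [T2Space G] (P T : Subgroup G)
    [hf : Finite (⁅P, T⁆ : Subgroup G)] :
    closedCommutator P.topologicalClosure T.topologicalClosure ≤ ⁅P, T⁆ := by
  have hc : IsClosed ((⁅P, T⁆ : Subgroup G) : Set G) := Set.Finite.isClosed hf
  refine Subgroup.topologicalClosure_minimal _ ?_ hc
  rw [Subgroup.commutator_le]
  intro x hx y hy
  have hmem : (x, y) ∈ closure ((P : Set G) ×ˢ (T : Set G)) := by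
    rw [closure_prod_eq]; exact ⟨hx, hy⟩
  have hcont : Continuous fun p : G × G => ⁅p.1, p.2⁆ := by
    simp only [commutatorElement_def]; fun_prop
  refine closure_minimal (t := {p : G × G | ⁅p.1, p.2⁆ ∈ (⁅P, T⁆ : Subgroup G)}) ?_
    (hc.preimage hcont) hmem
  rintro ⟨p, t⟩ ⟨hp, ht⟩
  exact Subgroup.commutator_mem_commutator hp ht

end Topology

/-! ### Haar measure and translates -/

section Measure

variable {G : Type*} [Group G] [TopologicalSpace G] [IsTopologicalGroup G] [CompactSpace G]
  [MeasurableSpace G] [BorelSpace G]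

instance : IsProbabilityMeasure (normalizedHaar G) := by
  constructor
  have := Measure.haarMeasure_self (K₀ := (⊤ : TopologicalSpace.PositiveCompacts G))
  simpa [normalizedHaar] using this

instance : (normalizedHaar G).Regular := by unfold normalizedHaar; infer_instance

instance : (normalizedHaar G).IsMulLeftInvariant := by unfold normalizedHaar; infer_instance

/-- Two of the first `⌊1 / c⌋ + 1` translates by a sequence `g` of a measurable set of measure at
least `c` in a compact group intersect. -/
theorem exists_mul_eq_mul_of_le_measureReal {X : Set G} (hX : MeasurableSet X) {c : ℝ} (hc : 0 < c)
    (h : c ≤ (normalizedHaar G).real X) (g : ℕ → G) :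
    ∃ i j, i < j ∧ j ≤ ⌊1 / c⌋₊ ∧ ∃ x ∈ X, ∃ y ∈ X, g i * x = g j * y := by
  have hsum : (normalizedHaar G).real Set.univ <
      ∑ i ∈ Finset.range (⌊1 / c⌋₊ + 1), (normalizedHaar G).real (g i • X) := by
    have : ∀ i, (normalizedHaar G).real (g i • X) = (normalizedHaar G).real X := fun i => by
      rw [Measure.real, measure_smul]; rfl
    simp only [this, Finset.sum_const, Finset.card_range, nsmul_eq_mul, probReal_univ]
    have h1 := Nat.lt_floor_add_one (1 / c)
    rw [div_lt_iff₀ hc] at h1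
    push_cast
    exact h1.trans_le (mul_le_mul_of_nonneg_left h (by positivity))
  obtain ⟨i, hi, j, hj, hij, z, hzi, hzj⟩ :=
    exists_nonempty_inter_of_measureReal_univ_lt_sum_measureReal (fun i _ => hX.const_smul (g i)) hsum
  obtain ⟨x, hx, rfl⟩ := hzi
  obtain ⟨y, hy, hxy⟩ := hzj
  rw [Finset.mem_range, Nat.lt_succ_iff] at hi hj
  rcases hij.lt_or_gt with hlt | hlt
  · exact ⟨i, j, hlt, hj, x, hx, y, hy, hxy.symm⟩
  · exact ⟨j, i, hlt, hi, y, hy, x, hx, hxy⟩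

theorem index_le_of_le_measureReal (H : Subgroup G) (hH : IsClosed (H : Set G)) {c : ℝ} (hc : 0 < c)
    (h : c ≤ (normalizedHaar G).real H) : H.index ≠ 0 ∧ H.index ≤ ⌊1 / c⌋₊ := by
  have key : ∀ f : Fin (⌊1 / c⌋₊ + 1) → G ⧸ H, ¬ Function.Injective f := by
    intro f hf
    -- `Fin.ofNat` extends `f` periodically to `ℕ`; only indices up to `⌊1 / c⌋₊` matter, where
    -- nothing wraps around.
    obtain ⟨i, j, hij, hj, x, hx, y, hy, hxy⟩ := exists_mul_eq_mul_of_le_measureReal hH.measurableSet hc h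
      fun i => (f (Fin.ofNat _ i)).out
    have heq : f (Fin.ofNat _ i) = f (Fin.ofNat _ j) := by
      rw [← (f (Fin.ofNat _ i)).out_eq', ← (f (Fin.ofNat _ j)).out_eq', QuotientGroup.eq]
      have : (f (Fin.ofNat _ i)).out⁻¹ * (f (Fin.ofNat _ j)).out = x * y⁻¹ := by
        rw [inv_mul_eq_iff_eq_mul, ← mul_assoc, hxy, mul_inv_cancel_right]
      rw [this]
      exact H.mul_mem hx (H.inv_mem hy)
    have := congrArg Fin.val (hf heq)
    simp only [Fin.val_ofNat] at this
    rw [Nat.mod_eq_of_lt (by omega), Nat.mod_eq_of_lt (by omega)] at this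
    omega
  have hfin : Finite (G ⧸ H) := by
    by_contra hinf
    rw [not_finite_iff_infinite] at hinf
    exact key (fun i => Infinite.natEmbedding _ i) fun i j hij =>
      Fin.ext ((Infinite.natEmbedding _).injective hij)
  refine ⟨Subgroup.index_ne_zero_of_finite, ?_⟩
  by_contra! hlt
  have e := Finite.equivFin (G ⧸ H)
  exact key (fun i => e.symm (Fin.castLE hlt i)) (e.symm.injective.comp (Fin.castLE_injective hlt))

end Measure

/-! ### Sections of closed sets that need not be product measurable -/

section Sections

variable {X Y : Type*} [TopologicalSpace X] [TopologicalSpace Y] [CompactSpace Y]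

/-- The complement is the projection along the compact space `Y` of a closed set. -/
theorem IsClosed.isOpen_setOf_section_subset {R : Set (X × Y)} (hR : IsClosed R) {U : Set Y}
    (hU : IsOpen U) : IsOpen {x | Prod.mk x ⁻¹' R ⊆ U} := by
  have hc : IsClosed (Prod.fst '' (R ∩ Prod.snd ⁻¹' Uᶜ)) :=
    isClosedMap_fst_of_compactSpace _ (hR.inter (hU.isClosed_compl.preimage continuous_snd))
  rw [← isClosed_compl_iff]
  convert hc using 1
  ext x
  simp [Set.not_subset]

variable [MeasurableSpace Y] (μ : Measure Y) [IsProbabilityMeasure μ] [μ.OuterRegular]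

/-- The measure of the section is upper semicontinuous: an open `U` of measure below `c` containing
one section contains all nearby ones. -/
theorem IsClosed.isClosed_setOf_le_measureReal_section {R : Set (X × Y)} (hR : IsClosed R) (c : ℝ) :
    IsClosed {x | c ≤ μ.real (Prod.mk x ⁻¹' R)} := by
  rw [← isOpen_compl_iff, isOpen_iff_mem_nhds]
  intro x hx
  simp only [Set.mem_compl_iff, Set.mem_ofPred_eq, not_le] at hx
  rw [Measure.real, ← ENNReal.lt_ofReal_iff_toReal_lt (measure_ne_top _ _)] at hx
  obtain ⟨U, hsub, hU, hlt⟩ := Set.exists_isOpen_lt_of_lt _ _ hx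
  filter_upwards [(hR.isOpen_setOf_section_subset hU).mem_nhds hsub] with z hz
  simp only [Set.mem_compl_iff, Set.mem_ofPred_eq, not_le]
  rw [Measure.real, ← ENNReal.lt_ofReal_iff_toReal_lt (measure_ne_top _ _)]
  exact (measure_mono hz).trans_lt hlt

variable [MeasurableSpace X] [BorelSpace X] [BorelSpace Y] (ν : Measure X) [IsProbabilityMeasure ν]
  [ν.OuterRegular]

/-- A closed subset of a product of compact probability spaces of product outer measure at least `2 * c`
has sections of measure at least `c` over a set of measure at least `c`. -/
theorem IsClosed.le_measureReal_setOf_le_measureReal_section [CompactSpace X] {R : Set (X × Y)}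
    (hR : IsClosed R) {c : ℝ} (h : 2 * c ≤ (ν.prod μ).real R) :
    c ≤ ν.real {x | c ≤ μ.real (Prod.mk x ⁻¹' R)} := by
  by_contra! hlt
  have hc : 0 < c := measureReal_nonneg.trans_lt hlt
  rw [Measure.real, ← ENNReal.lt_ofReal_iff_toReal_lt (measure_ne_top _ _)] at hlt
  obtain ⟨W, hsub, hW, hWlt⟩ := Set.exists_isOpen_lt_of_lt _ _ hlt
  -- Over the compact set `Wᶜ`, `R` is enclosed in a measurable `M` to which Fubini applies. Locally
  -- `M` is a rectangle; gluing only over the part of the base not yet covered keeps the sections of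
  -- measure at most `c`.
  have hcov : ∃ V, MeasurableSet V ∧ Wᶜ ⊆ V ∧ ∃ M : Set (X × Y), MeasurableSet M ∧
      M ⊆ Prod.fst ⁻¹' V ∧ R ∩ Prod.fst ⁻¹' V ⊆ M ∧
      ∀ x, μ (Prod.mk x ⁻¹' M) ≤ ENNReal.ofReal c := by
    refine hW.isClosed_compl.isCompact.induction_on (p := fun s => ∃ V, MeasurableSet V ∧ s ⊆ V ∧
      ∃ M : Set (X × Y), MeasurableSet M ∧ M ⊆ Prod.fst ⁻¹' V ∧ R ∩ Prod.fst ⁻¹' V ⊆ M ∧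
      ∀ x, μ (Prod.mk x ⁻¹' M) ≤ ENNReal.ofReal c) ?_ ?_ ?_ ?_
    · exact ⟨∅, .empty, subset_rfl, ∅, .empty, by simp, by simp, by simp⟩
    · rintro s t hst ⟨V, hV, htV, h⟩
      exact ⟨V, hV, hst.trans htV, h⟩
    · rintro s t ⟨V, hV, hsV, M, hM, hMV, hRM, hμ⟩ ⟨V', hV', htV', M', hM', hMV', hRM', hμ'⟩
      refine ⟨V ∪ V', hV.union hV', Set.union_subset_union hsV htV',
        M ∪ (M' \ Prod.fst ⁻¹' V), hM.union (hM'.diff (measurable_fst hV)), ?_, ?_, fun x => ?_⟩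
      · rintro p (hp | hp)
        · exact .inl (hMV hp)
        · exact .inr (hMV' hp.1)
      · rintro p ⟨hp, hpV⟩
        by_cases hpv : p.1 ∈ V
        · exact .inl (hRM ⟨hp, hpv⟩)
        · exact .inr ⟨hRM' ⟨hp, hpV.resolve_left hpv⟩, hpv⟩
      · by_cases hx : x ∈ V
        · refine (measure_mono ?_).trans (hμ x)
          rintro y (hy | hy)
          · exact hy
          · exact absurd hx hy.2
        · refine (measure_mono ?_).trans (hμ' x)
          rintro y (hy | hy)
          · exact absurd (hMV hy) hx
          · exact hy.1
    · intro x hx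
      have hx' : ¬ c ≤ μ.real (Prod.mk x ⁻¹' R) := fun h => hx (hsub h)
      rw [not_le, Measure.real, ← ENNReal.lt_ofReal_iff_toReal_lt (measure_ne_top _ _)] at hx'
      obtain ⟨U, hxU, hU, hUlt⟩ := Set.exists_isOpen_lt_of_lt _ _ hx'
      have hV := hR.isOpen_setOf_section_subset hU
      refine ⟨_, mem_nhdsWithin_of_mem_nhds (hV.mem_nhds hxU), _, hV.measurableSet, subset_rfl,
        {x | Prod.mk x ⁻¹' R ⊆ U} ×ˢ U, hV.measurableSet.prod hU.measurableSet,
        fun p hp => hp.1, fun p hp => ⟨hp.2, hp.2 hp.1⟩, fun z => ?_⟩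
      exact (measure_mono fun y hy => hy.2).trans hUlt.le
  obtain ⟨V, -, hWV, M, hM, -, hRM, hμ⟩ := hcov
  have hRW : R ⊆ W ×ˢ Set.univ ∪ M := by
    intro p hp
    by_cases hpW : p.1 ∈ W
    · exact .inl ⟨hpW, trivial⟩
    · exact .inr (hRM ⟨hp, hWV hpW⟩)
  have hMle : ν.prod μ M ≤ ENNReal.ofReal c := by
    rw [Measure.prod_apply hM]
    calc ∫⁻ x, μ (Prod.mk x ⁻¹' M) ∂ν ≤ ∫⁻ _, ENNReal.ofReal c ∂ν := lintegral_mono hμ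
      _ = ENNReal.ofReal c := by simp
  have hlt : ν.prod μ R < ENNReal.ofReal (2 * c) := by
    calc ν.prod μ R ≤ ν.prod μ (W ×ˢ Set.univ) + ν.prod μ M :=
          (measure_mono hRW).trans (measure_union_le _ _)
      _ = ν W + ν.prod μ M := by rw [Measure.prod_prod, measure_univ, mul_one]
      _ < ENNReal.ofReal c + ENNReal.ofReal c :=
          ENNReal.add_lt_add_of_lt_of_le (measure_ne_top _ _) hWlt hMle
      _ = ENNReal.ofReal (2 * c) := by rw [← ENNReal.ofReal_add hc.le hc.le, two_mul]
  rw [ENNReal.lt_ofReal_iff_toReal_lt (measure_ne_top _ _)] at hlt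
  exact absurd h (not_le.2 hlt)

end Sections

/-! ### From commuting probability to powers with large centralizer -/

section Haar

variable {G : Type*} [Group G] [TopologicalSpace G] [IsTopologicalGroup G] [CompactSpace G]
  [T2Space G] [MeasurableSpace G] [BorelSpace G]

/-- If `Pr(⟨g⟩, G) ≥ 2 * c` then the centralizer of some `g ^ k` with `1 ≤ k ≤ 1 / c` has index at most
`(1 / c) ^ 2`. -/
theorem exists_index_centralizer_pow_le (g : G) {c : ℝ} (hc : 0 < c)
    (h : 2 * c ≤ commutingProb (monothetic g)) :
    ∃ k, 0 < k ∧ k ≤ ⌊1 / c⌋₊ ∧ (Subgroup.centralizer {g ^ k}).index ≠ 0 ∧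
      (Subgroup.centralizer {g ^ k}).index ≤ ⌊1 / c⌋₊ * ⌊1 / c⌋₊ := by
  have hR : IsClosed (commutingPairs (monothetic g)) :=
    isClosed_eq (by fun_prop) (by fun_prop)
  have hX := hR.isClosed_setOf_le_measureReal_section (normalizedHaar G) c
  have hle := hR.le_measureReal_setOf_le_measureReal_section (normalizedHaar G)
    (normalizedHaar (monothetic g)) h
  have hg : g ∈ monothetic g := Subgroup.le_topologicalClosure _ (Subgroup.mem_zpowers g)
  -- The translation takes place in `monothetic g`, where the elements with a centralizer of measure
  -- at least `c` have measure at least `c`.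
  obtain ⟨i, j, hij, hj, x, hx, y, hy, hxy⟩ :=
    exists_mul_eq_mul_of_le_measureReal hX.measurableSet hc hle fun i => (⟨g, hg⟩ : monothetic g) ^ i
  have hsec : ∀ x : monothetic g,
      Prod.mk x ⁻¹' commutingPairs (monothetic g) = (Subgroup.centralizer {(x : G)} : Set G) := by
    intro x
    ext z
    rw [SetLike.mem_coe, Subgroup.mem_centralizer_singleton_iff]
    exact eq_comm
  have hindex : ∀ x ∈ {x | c ≤ (normalizedHaar G).real
      (Prod.mk x ⁻¹' commutingPairs (monothetic g))},
      (Subgroup.centralizer {(x : G)}).index ≠ 0 ∧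
        (Subgroup.centralizer {(x : G)}).index ≤ ⌊1 / c⌋₊ := by
    intro x hx
    rw [Set.mem_ofPred_eq, hsec] at hx
    refine index_le_of_le_measureReal _ ?_ hc hx
    rw [← hsec]
    exact hR.preimage (by fun_prop)
  have hk : g ^ (j - i) = x * (y : G)⁻¹ := by
    have h1 : g ^ i * (x : G) = g ^ j * y := congrArg Subtype.val hxy
    rw [← Nat.add_sub_cancel' hij.le, pow_add, mul_assoc, mul_right_inj] at h1
    rw [h1, mul_inv_cancel_right]
  have hsub : Subgroup.centralizer {(x : G)} ⊓ Subgroup.centralizer {(y : G)} ≤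
      Subgroup.centralizer {g ^ (j - i)} := by
    intro z hz
    simp only [Subgroup.mem_inf, Subgroup.mem_centralizer_singleton_iff] at hz ⊢
    rw [hk]
    exact Commute.mul_right (a := z) hz.1 (Commute.inv_right hz.2)
  obtain ⟨hx0, hxn⟩ := hindex x hx
  obtain ⟨hy0, hyn⟩ := hindex y hy
  have : (Subgroup.centralizer {(x : G)} ⊓ Subgroup.centralizer {(y : G)}).FiniteIndex :=
    ⟨Subgroup.index_inf_ne_zero hx0 hy0⟩
  exact ⟨j - i, Nat.sub_pos_of_lt hij, (Nat.sub_le _ _).trans hj,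
    (Subgroup.finiteIndex_of_le hsub).index_ne_zero,
    (Subgroup.index_antitone hsub).trans (Subgroup.index_inf_le.trans (Nat.mul_le_mul hxn hyn))⟩

end Haar

/-! ### The main theorem -/

theorem mainTheorem1 (ε : ℝ) (hε : 0 < ε) :
    ∃ N : ℕ, ∀ (G : Type*) [Group G] [TopologicalSpace G] [IsTopologicalGroup G]
      [CompactSpace G] [T2Space G] [MeasurableSpace G] [BorelSpace G] (K : Subgroup G),
      IsClosed (K : Set G) → IsEpsCentral ε K →
        ∃ (e : ℕ) (T : Subgroup G),
          0 < e ∧ e ≤ N ∧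
          T.Normal ∧ IsClosed (T : Set G) ∧
          T.FiniteIndex ∧ T.index ≤ N ∧
          Finite (closedCommutator (powerSubgroup K e) T) ∧
          Nat.card (closedCommutator (powerSubgroup K e) T) ≤ N := by
  set m := ⌊1 / (ε / 2)⌋₊
  set n := m * m
  set d := (m !) * (n !)
  -- The summands bound `e`, the index of `T` and the order of the commutator subgroup, in this
  -- order.
  refine ⟨d * d + (n !) + commutatorBound n ^ commutatorBound n, ?_⟩
  intro G _ _ _ _ _ _ _ K _ hK
  have hpow : ∀ k ∈ K, (Subgroup.centralizer {k ^ m !}).index ≠ 0 ∧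
      (Subgroup.centralizer {k ^ m !}).index ≤ n := by
    intro k hk
    obtain ⟨i, hi0, him, h0, hn⟩ := exists_index_centralizer_pow_le k (half_pos hε)
      (by rw [mul_div_cancel₀ _ two_ne_zero]; exact hK k hk)
    have hle : Subgroup.centralizer {k ^ i} ≤ Subgroup.centralizer {k ^ m !} := by
      obtain ⟨c, hc⟩ := Nat.dvd_factorial hi0 him
      intro z hz
      rw [Subgroup.mem_centralizer_singleton_iff] at hz ⊢
      rw [hc, pow_mul]
      exact Commute.pow_right (a := z) hz c
    have : (Subgroup.centralizer {k ^ i}).FiniteIndex := ⟨h0⟩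
    exact ⟨(Subgroup.finiteIndex_of_le hle).index_ne_zero,
      (Subgroup.index_antitone hle).trans hn⟩
  obtain ⟨T, hT, hT0, hTn, hf, hc⟩ := K.exists_card_commutator_pow_le hpow
  obtain ⟨h0, hi⟩ := T.index_topologicalClosure_le hT0
  have hle : closedCommutator (powerSubgroup K (d * d)) T.topologicalClosure ≤ _ :=
    closedCommutator_topologicalClosure_le _ T
  refine ⟨d * d, T.topologicalClosure, by positivity, by omega,
    T.is_normal_topologicalClosure, T.isClosed_topologicalClosure, ⟨h0⟩, by omega,
    Finite.of_injective _ (Subgroup.inclusion_injective hle), ?_⟩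
  have := (Nat.card_le_card_of_injective _ (Subgroup.inclusion_injective hle)).trans hc
  omega
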